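/- Let $\mathbf H$ be the parity-check matrix of a QC-LDPC code: an $m_b\times n_b$ array of $p\times p$ binary blocks ($p\ge 1$), each of them zero or a circulant permutation matrix. Let $\mathcal S$ be a leafless elementary trapping set (LETS): a non-empty set of variable nodes such that every neighbouring check node of $\mathcal S$ has degree $1$ or $2$ in the subgraph of the Tanner graph induced by $\mathcal S$, and every variable node of $\mathcal S$ is adjacent to at least two check nodes of even induced degree (the missatisfied check nodes). The state variables of $\mathcal S$ are the messages $v\to c$ along the edges between variable nodes $v\in\mathcal S$ and missatisfied check nodes $c$. The flooding transition matrix $\mathbf A$ is the $0$-$1$ matrix, indexed by the state variables, whose entry in row $v\to c$ and column $v'\to c'$ is $1$ iff $c'\neq c$, $c'$ is adjacent to $v$, and $v'\neq v$. The row blocks of $\mathbf H$ are processed one after another, in some fixed order. Let $L_1,\dots,L_J$ be, in this order, the row blocks (layers) that contain missatisfied check nodes of $\mathcal S$. The state variable $v\to c$ is updated in the layer containing $c$, and $n_{L_j}$ is the number of state variables updated in $L_j$. Let $\mathcal A_j$ be the matrix whose rows belonging to the state variables of $L_j$ are those of $\mathbf A$ and whose other rows are those of the identity matrix, and let $\tilde{\mathbf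 A}_{J\to1}=\mathcal A_J\mathcal A_{J-1}\cdots\mathcal A_1$. The digraphs $D_f$ and $D_l$ have the state variables as nodes, with an edge from $x$ to $y$ iff the entry in row $y$ and column $x$ of $\mathbf A$, respectively of $\tilde{\mathbf A}_{J\to1}$, is non-zero. A square matrix $\mathbf M$ is reducible if for some permutation matrix $\mathbf P$ the matrix $\mathbf P\mathbf M\mathbf P^T$ is of the form $\begin{pmatrix}\mathbf M_a&\mathbf M_c\\ \mathbf 0&\mathbf M_b\end{pmatrix}$ with square blocks $\mathbf M_a,\mathbf M_b$ of positive size; a non-negative matrix that is not reducible is irreducible. A Frobenius normal form of $\mathbf M$ is a matrix $\mathbf P\mathbf M\mathbf P^T$, with $\mathbf P$ a permutation matrix, partitioned in block upper triangular form, such that each diagonal block is either irreducible or a $1\times1$ zero matrix. A $1\times 1$ zero block is not counted as an irreducible block. Then the following hold. 1. $\tilde{\mathbf A}_{J\to1}$ is non-negative and reducible. Moreover $J\ge1$, $n_{L_1}\ge 1$, and the first column block of $\tilde{\mathbf A}_{J\to1}$ (the columns of the $n_{L_1}$ state variables updated in $L_1$) is zero. 2. If a state variable $x$ is updated in $L_k$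 and all edges leaving $x$ in $D_f$ lead to state variables updated in layers $L_j$ with $j>k$, then $x$ has no outgoing edges in $D_l$. The number $n_z$ of nodes of $D_l$ without outgoing edges, i.e. of zero columns of $\tilde{\mathbf A}_{J\to1}$, satisfies $n_z\ge n_{L_1}$. 3. Suppose that $\mathbf A$ is irreducible. Then the digraph that remains when all nodes without outgoing edges, and their incoming edges, are removed from $D_l$ is strongly connected. Moreover $\tilde{\mathbf A}_{J\to1}$ has a Frobenius normal form, and every Frobenius normal form of $\tilde{\mathbf A}_{J\to1}$ has exactly one irreducible diagonal block, all its other diagonal blocks being $1\times1$ zero matrices. -/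

import Mathlib

namespace LETS

/-! ## Reducibility and the Frobenius normal form -/

section Frobenius

variable {ι : Type*}

/-- Some simultaneous permutation of the rows and columns (`P M Pᵀ`) brings `M` into the form
`[[M_a, M_c], [0, M_b]]`, with `M_a` and `M_b` square of sizes `k, l > 0`. -/
def IsReducible (M : Matrix ι ι ℝ) : Prop :=
  ∃ (k l : ℕ) (e : ι ≃ Fin k ⊕ Fin l), 0 < k ∧ 0 < l ∧ (M.reindex e e).toBlocks₂₁ = 0

/-- An irreducible non-negative matrix. By this definition every non-negative `1 × 1` matrix,
including the zero matrix, is irreducible. -/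
def IsIrreducible (M : Matrix ι ι ℝ) : Prop :=
  (∀ i j, 0 ≤ M i j) ∧ ¬ IsReducible M

/-- The `1 × 1` zero matrix. -/
def IsNullOne {d : ℕ} (M : Matrix (Fin d) (Fin d) ℝ) : Prop :=
  d = 1 ∧ M = 0

/-- The data of a simultaneous permutation of rows and columns, together with a partition of the
permuted index set into `t` consecutive non-empty blocks. -/
structure BlockPerm (ι : Type*) where
  /-- number of diagonal blocks -/
  t : ℕ
  /-- sizes of the diagonal blocks -/
  size : Fin t → ℕ
  size_pos : ∀ i, 0 < size i
  /-- the permutation -/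
  e : ι ≃ (i : Fin t) × Fin (size i)

/-- The `i`-th diagonal block of the permuted matrix. -/
def BlockPerm.block (F : BlockPerm ι) (M : Matrix ι ι ℝ) (i : Fin F.t) :
    Matrix (Fin (F.size i)) (Fin (F.size i)) ℝ :=
  (M.reindex F.e F.e).blockDiag' i

/-- `F` brings `M` into Frobenius normal form: the permuted matrix is block upper triangular and
each of its diagonal blocks is irreducible or a `1 × 1` zero matrix. -/
def BlockPerm.IsFrobeniusNormalForm (F : BlockPerm ι) (M : Matrix ι ι ℝ) : Prop :=
  (M.reindex F.e F.e).BlockTriangular Sigma.fst ∧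
    ∀ i, IsIrreducible (F.block M i) ∨ IsNullOne (F.block M i)

/-- The `i`-th diagonal block is one of the irreducible diagonal blocks, which are distinguished
from the `1 × 1` zero blocks. -/
def BlockPerm.IsIrreducibleBlock (F : BlockPerm ι) (M : Matrix ι ι ℝ) (i : Fin F.t) : Prop :=
  IsIrreducible (F.block M i) ∧ ¬ IsNullOne (F.block M i)

end Frobenius

/-! ## Digraphs of transition matrices -/

section Digraphs

variable {ι : Type*}

/-- The digraph of a transition matrix `M`: there is an edge from `x` to `y` when the new value of
`y` depends on the old value of `x`, so the adjacency matrix is (the support of) `Mᵀ`. -/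
def digraph (M : Matrix ι ι ℝ) : Digraph ι where
  Adj x y := M y x ≠ 0

/-- There is a directed walk between any two nodes. -/
def StronglyConnected (D : Digraph ι) : Prop :=
  ∀ x y, Relation.ReflTransGen D.Adj x y

/-- What is left of `D` when all nodes without outgoing edges (and their incoming edges) are
removed. -/
def removeSinks (D : Digraph ι) : Digraph {x : ι // ∃ y, D.Adj x y} where
  Adj x y := D.Adj x y

end Digraphs

/-! ## QC-LDPC codes and leafless elementary trapping sets -/

/-- Check nodes: (row block, row within the block). -/
abbrev CN (mb p : ℕ) := Fin mb × ZMod p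

/-- Variable nodes: (column block, column within the block). -/
abbrev VN (nb p : ℕ) := Fin nb × ZMod p

/-- `H` is an `mb × nb` array of `p × p` blocks, each of them zero or a circulant permutation
matrix. -/
def IsQC {mb nb p : ℕ} (H : Matrix (CN mb p) (VN nb p) (ZMod 2)) : Prop :=
  ∀ i j, (∀ r c, H (i, r) (j, c) = 0) ∨
    ∃ s : ZMod p, ∀ r c, H (i, r) (j, c) = if c = r + s then 1 else 0

section TrappingSets

variable {mb nb p : ℕ} (H : Matrix (CN mb p) (VN nb p) (ZMod 2)) (S : Finset (VN nb p))

/-- The degree of the check node `c` in the subgraph of the Tanner graph induced by `S`. -/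
def cnDegree (c : CN mb p) : ℕ := (S.filter fun v => H c v = 1).card

/-- A missatisfied check node: a neighbour of `S` that has even degree in the induced subgraph. -/
def IsMissatisfied (c : CN mb p) : Prop := 0 < cnDegree H S c ∧ Even (cnDegree H S c)

instance : DecidablePred (IsMissatisfied H S) := fun _ => inferInstanceAs (Decidable (_ ∧ _))

/-- State variables: the messages `v → c` on the edges of the induced subgraph from variable nodes
`v` of `S` to missatisfied check nodes `c`. -/
abbrev StateVar := {x : VN nb p × CN mb p // x.1 ∈ S ∧ IsMissatisfied H S x.2 ∧ H x.2 x.1 = 1}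

/-- The transition matrix `A` of the flooding schedule: the new message `v → c` is the sum of the
old messages `v' → c'` over the missatisfied check nodes `c' ≠ c` adjacent to `v`, where `v'` is a
neighbour of `c'` in `S` other than `v`. -/
def floodingMatrix : Matrix (StateVar H S) (StateVar H S) ℝ :=
  Matrix.of fun x y => if y.1.2 ≠ x.1.2 ∧ H y.1.2 x.1.1 = 1 ∧ y.1.1 ≠ x.1.1 then 1 else 0

variable [NeZero p]

/-- `S` is a leafless elementary trapping set: it is non-empty, every check node has degree `0`
(no neighbour in `S`), `1` or `2` in the induced subgraph, and every variable node of `S` is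
connected to at least two missatisfied check nodes. -/
structure IsLETS : Prop where
  nonempty : S.Nonempty
  elementary : ∀ c : CN mb p, cnDegree H S c ≤ 2
  leafless : ∀ v ∈ S, 2 ≤ (Finset.univ.filter fun c => IsMissatisfied H S c ∧ H c v = 1).card

/-! ## The row layered schedule

In every iteration the row blocks of `H` are processed one after another; `π z` is the position at
which row block `z` is processed. -/

variable (π : Equiv.Perm (Fin mb))

/-- The positions of the row blocks that contain missatisfied check nodes of `S`. -/
def layers : Finset (Fin mb) :=
  (Finset.univ.filter fun c => IsMissatisfied H S c).image fun c => π c.1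

/-- The number `J` of layers of `S`. -/
def numLayers : ℕ := (layers H S π).card

lemma mem_layers (x : StateVar H S) : π x.1.2.1 ∈ layers H S π :=
  Finset.mem_image.2 ⟨x.1.2, Finset.mem_filter.2 ⟨Finset.mem_univ _, x.2.2.1⟩, rfl⟩

/-- The layer in which the state variable `x` is updated. The layers are numbered `0, …, J - 1` in
the order in which they are processed. -/
def layer (x : StateVar H S) : Fin (numLayers H S π) :=
  ((layers H S π).orderIsoOfFin rfl).symm ⟨π x.1.2.1, mem_layers H S π x⟩

/-- The number of state variables that are updated in layer `j`. -/
noncomputable def layerSize (j : Fin (numLayers H S π)) : ℕ :=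
  Nat.card {x : StateVar H S // layer H S π x = j}

/-- The transition matrix of layer `j`: the rows of the state variables updated in layer `j` are
those of the flooding matrix, all other rows are those of the identity matrix. -/
def layerMatrix (j : Fin (numLayers H S π)) : Matrix (StateVar H S) (StateVar H S) ℝ :=
  Matrix.of fun x y =>
    if layer H S π x = j then floodingMatrix H S x y else (1 : Matrix _ _ ℝ) x y

/-- The transition matrix of the layered decoder: the product of the transition matrices of the
layers, from the last layer (leftmost factor) to the first one (rightmost factor). -/
def layeredMatrix : Matrix (StateVar H S) (StateVar H S) ℝ :=
  ((List.ofFn (layerMatrix H S π)).reverse).prod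

/-- The number `n_z` of zero columns of the transition matrix of the layered decoder. -/
noncomputable def numZeroColumns : ℕ :=
  Nat.card {y : StateVar H S // ∀ x, layeredMatrix H S π x y = 0}

end TrappingSets

end LETS

/-!
One iteration of the layered decoder is a block Gauss–Seidel sweep: writing `M` for the layered
matrix and `ℓ` for the layer function, a row of `M` is the corresponding row of `A` in which the
inputs from earlier layers have been replaced by their new values. For a non-negative `A` this
describes the layered digraph completely: `x` has an edge to `y` if and only if `D_f` has a walk
from `x` to `y` whose first step does not go to a later layer and whose other steps all do. Hence
a node all of whose flooding edges go to later layers is a sink, and cutting a walk of `D_f` at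
the steps that do not go to a later layer turns it into a walk of `D_l` through non-sinks.

In a block triangular form the block index decreases along every walk, so all the non-sinks lie in
one block if they are strongly connected. Any other block has only zero columns, hence is the
`1 × 1` zero matrix if it is irreducible.
-/

namespace LETS

section Reducibility

variable {ι : Type*}

lemma StronglyConnected.exists_adj [Nontrivial ι] {D : Digraph ι} (hD : StronglyConnected D)
    (x : ι) : ∃ y, D.Adj x y := by
  obtain ⟨z, hz⟩ := exists_ne x
  obtain rfl | ⟨y, hxy, -⟩ := (hD x z).cases_head
  · exact absurd rfl hz
  · exact ⟨y, hxy⟩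

lemma IsReducible.not_stronglyConnected {M : Matrix ι ι ℝ} (h : IsReducible M) :
    ¬ StronglyConnected (digraph M) := by
  obtain ⟨k, l, e, hk, hl, hM⟩ := h
  intro hconn
  have hclosed : ∀ y, Relation.ReflTransGen (digraph M).Adj (e.symm (.inl ⟨0, hk⟩)) y →
      ∃ a, y = e.symm (.inl a) := by
    intro y hy
    induction hy with
    | refl => exact ⟨_, rfl⟩
    | @tail _ z _ hyz ih =>
      obtain ⟨a, rfl⟩ := ih
      obtain ⟨a' | b, rfl⟩ := e.symm.surjective z
      · exact ⟨a', rfl⟩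
      · exact absurd (congrFun (congrFun hM b) a) hyz
  obtain ⟨a, ha⟩ := hclosed _ (hconn _ (e.symm (.inr ⟨0, hl⟩)))
  simp at ha

lemma isReducible_of_not_stronglyConnected [Finite ι] {M : Matrix ι ι ℝ}
    (h : ¬ StronglyConnected (digraph M)) : IsReducible M := by
  classical
  simp only [StronglyConnected, not_forall] at h
  obtain ⟨x, y, hxy⟩ := h
  let C : Set ι := {z | Relation.ReflTransGen (digraph M).Adj x z}
  have : Nonempty {z // z ∈ C} := ⟨⟨x, .refl⟩⟩
  have : Nonempty {z // z ∉ C} := ⟨⟨y, hxy⟩⟩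
  let eC := Finite.equivFin {z // z ∈ C}
  let eC' := Finite.equivFin {z // z ∉ C}
  refine ⟨_, _, (Equiv.sumCompl (· ∈ C)).symm.trans (eC.sumCongr eC'), Nat.card_pos,
    Nat.card_pos, ?_⟩
  ext b a
  by_contra hba
  exact (eC'.symm b).2 ((eC.symm a).2.tail hba)

lemma isReducible_iff_not_stronglyConnected [Finite ι] {M : Matrix ι ι ℝ} :
    IsReducible M ↔ ¬ StronglyConnected (digraph M) :=
  ⟨IsReducible.not_stronglyConnected, isReducible_of_not_stronglyConnected⟩

lemma isIrreducible_iff_stronglyConnected [Finite ι] {M : Matrix ι ι ℝ} :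
    IsIrreducible M ↔ (∀ i j, 0 ≤ M i j) ∧ StronglyConnected (digraph M) := by
  rw [IsIrreducible, isReducible_iff_not_stronglyConnected, not_not]

lemma isReducible_of_column_eq_zero [Finite ι] [Nontrivial ι] {M : Matrix ι ι ℝ} {x : ι}
    (hx : ∀ y, M y x = 0) : IsReducible M :=
  isReducible_of_not_stronglyConnected fun hconn =>
    let ⟨y, hxy⟩ := hconn.exists_adj x
    hxy (hx y)

lemma IsIrreducible.isNullOne_iff_eq_zero {d : ℕ} {M : Matrix (Fin d) (Fin d) ℝ}
    (hM : IsIrreducible M) (hd : 0 < d) : IsNullOne M ↔ M = 0 := by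
  refine ⟨And.right, fun h0 => ⟨?_, h0⟩⟩
  by_contra hd1
  have : Nontrivial (Fin d) := Fin.nontrivial_iff_two_le.2 (by omega)
  exact hM.2 (isReducible_of_column_eq_zero (x := ⟨0, hd⟩) fun y => by rw [h0]; rfl)

end Reducibility

lemma exists_monotone_surjective_fin (α : Type*) [Finite α] [Preorder α] :
    ∃ (t : ℕ) (f : α → Fin t),
      Monotone f ∧ Function.Surjective f ∧ ∀ x y, f x = f y → x ≤ y := by
  let L := LinearExtension (Antisymmetrization α (· ≤ ·))
  have : Finite L := inferInstanceAs (Finite (Quotient _))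
  have := Fintype.ofFinite L
  let g : L ≃o Fin (Fintype.card L) := (Fintype.orderIsoFinOfCardEq L rfl).symm
  let q : α → L := fun x => toLinearExtension (toAntisymmetrization (· ≤ ·) x)
  refine ⟨_, g ∘ q, g.monotone.comp (toLinearExtension.monotone.comp fun _ _ h => h),
    g.surjective.comp Quotient.mk_surjective, fun x y hxy => ?_⟩
  have hq : toAntisymmetrization (· ≤ ·) x = toAntisymmetrization (· ≤ ·) y := g.injective hxy
  exact toAntisymmetrization_le_toAntisymmetrization_iff.1 hq.le

namespace BlockPerm

variable {ι : Type*} {M : Matrix ι ι ℝ}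

/-- The block permutation whose blocks are the fibres of a surjective map `f`, in the order of
their values, for building Frobenius normal forms; within a fibre the order is arbitrary. -/
noncomputable def ofFibers [Finite ι] {t : ℕ} (f : ι → Fin t) (hf : Function.Surjective f) :
    BlockPerm ι where
  t := t
  size i := Nat.card {x // f x = i}
  size_pos i :=
    have : Nonempty {x // f x = i} := (hf i).elim fun x hx => ⟨⟨x, hx⟩⟩
    Nat.card_pos
  e := (Equiv.sigmaFiberEquiv f).symm.trans (Equiv.sigmaCongrRight fun _ => Finite.equivFin _)

lemma ofFibers_e_fst [Finite ι] {t : ℕ} (f : ι → Fin t) (hf : Function.Surjective f) (x : ι) :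
    ((ofFibers f hf).e x).1 = f x := rfl

lemma digraph_block_adj {F : BlockPerm ι} {i : Fin F.t} {a b : Fin (F.size i)} :
    (digraph (F.block M i)).Adj a b ↔
      (digraph M).Adj (F.e.symm ⟨i, a⟩) (F.e.symm ⟨i, b⟩) := Iff.rfl

lemma exists_eq_symm_of_fst_eq {F : BlockPerm ι} {x : ι} {i : Fin F.t} (hx : (F.e x).1 = i) :
    ∃ a, x = F.e.symm ⟨i, a⟩ := by
  subst hx
  exact ⟨(F.e x).2, (F.e.symm_apply_apply x).symm⟩

lemma blockTriangular_iff_forall_adj {F : BlockPerm ι} :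
    (M.reindex F.e F.e).BlockTriangular Sigma.fst ↔
      ∀ x y, (digraph M).Adj x y → (F.e y).1 ≤ (F.e x).1 := by
  refine ⟨fun h x y hxy => not_lt.1 fun hlt => hxy (by simpa using h hlt), fun h a b hba => ?_⟩
  by_contra hab
  exact hba.not_ge (by simpa using h (F.e.symm b) (F.e.symm a) hab)

lemma fst_le_of_reflTransGen {F : BlockPerm ι}
    (hF : (M.reindex F.e F.e).BlockTriangular Sigma.fst) {x y : ι}
    (hxy : Relation.ReflTransGen (digraph M).Adj x y) : (F.e y).1 ≤ (F.e x).1 := by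
  induction hxy with
  | refl => exact le_rfl
  | tail _ hyz ih => exact (blockTriangular_iff_forall_adj.1 hF _ _ hyz).trans ih

lemma reflTransGen_block {F : BlockPerm ι} (hF : (M.reindex F.e F.e).BlockTriangular Sigma.fst)
    {i : Fin F.t} {a b : Fin (F.size i)}
    (hab : Relation.ReflTransGen (digraph M).Adj (F.e.symm ⟨i, a⟩) (F.e.symm ⟨i, b⟩)) :
    Relation.ReflTransGen (digraph (F.block M i)).Adj a b := by
  generalize hx : F.e.symm ⟨i, a⟩ = x at hab
  induction hab using Relation.ReflTransGen.head_induction_on generalizing a with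
  | refl =>
    obtain rfl : a = b := by simpa using hx
    exact .refl
  | @head _ y hxy hyb ih =>
    subst hx
    have hyi : (F.e y).1 ≤ i := by simpa using blockTriangular_iff_forall_adj.1 hF _ _ hxy
    have hiy : i ≤ (F.e y).1 := by simpa using fst_le_of_reflTransGen hF hyb
    obtain ⟨c, rfl⟩ := exists_eq_symm_of_fst_eq (hyi.antisymm hiy)
    exact .head (digraph_block_adj.2 hxy) (ih rfl)

theorem exists_isFrobeniusNormalForm [Finite ι] (hM : ∀ x y, 0 ≤ M x y) :
    ∃ F : BlockPerm ι, F.IsFrobeniusNormalForm M := by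
  let _ : Preorder ι :=
    { le x y := Relation.ReflTransGen (digraph M).Adj y x
      le_refl _ := .refl
      le_trans _ _ _ hxy hyz := hyz.trans hxy }
  obtain ⟨t, f, hmono, hsurj, hf⟩ := exists_monotone_surjective_fin ι
  let F := ofFibers f hsurj
  have htri : (M.reindex F.e F.e).BlockTriangular Sigma.fst :=
    blockTriangular_iff_forall_adj.2 fun x y hxy => hmono (Relation.ReflTransGen.single hxy)
  have f_symm : ∀ (i : Fin F.t) (a : Fin (F.size i)), f (F.e.symm ⟨i, a⟩) = i := fun i a => by
    rw [← ofFibers_e_fst f hsurj, Equiv.apply_symm_apply]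
  exact ⟨F, htri, fun i => .inl (isIrreducible_iff_stronglyConnected.2 ⟨fun _ _ => hM _ _,
    fun a b => reflTransGen_block htri (hf _ _ ((f_symm i b).trans (f_symm i a).symm))⟩)⟩

lemma IsFrobeniusNormalForm.isNullOne_block_iff {F : BlockPerm ι}
    (hF : F.IsFrobeniusNormalForm M) (i : Fin F.t) :
    IsNullOne (F.block M i) ↔ F.block M i = 0 :=
  ⟨And.right, fun h0 => (hF.2 i).elim
    (fun hirr => (hirr.isNullOne_iff_eq_zero (F.size_pos i)).2 h0) id⟩

theorem IsFrobeniusNormalForm.existsUnique_isIrreducibleBlock {F : BlockPerm ι}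
    (hF : F.IsFrobeniusNormalForm M) (hconn : StronglyConnected (removeSinks (digraph M)))
    (hne : ∃ x y, (removeSinks (digraph M)).Adj x y) :
    ∃! i : Fin F.t, F.IsIrreducibleBlock M i ∧ ∀ k, k ≠ i → IsNullOne (F.block M k) := by
  obtain ⟨⟨u, hu⟩, ⟨v, hv⟩, huv : (digraph M).Adj u v⟩ := hne
  have hle : ∀ x y : {x // ∃ y, (digraph M).Adj x y}, (F.e y).1 ≤ (F.e x).1 := fun x y =>
    fst_le_of_reflTransGen hF.1 ((hconn x y).lift Subtype.val fun _ _ h => h)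
  have fst_eq : ∀ x, (∃ y, (digraph M).Adj x y) → (F.e x).1 = (F.e u).1 := fun x hx =>
    (hle ⟨u, hu⟩ ⟨x, hx⟩).antisymm (hle ⟨x, hx⟩ ⟨u, hu⟩)
  have eq_of_not_null : ∀ k, ¬ IsNullOne (F.block M k) → k = (F.e u).1 := by
    intro k hk
    obtain ⟨b, a, hab⟩ : ∃ b a, F.block M k b a ≠ 0 := by
      simpa [hF.isNullOne_block_iff, ← Matrix.ext_iff] using hk
    simpa using fst_eq _ ⟨_, digraph_block_adj.1 hab⟩
  have not_null : ¬ IsNullOne (F.block M (F.e u).1) := by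
    obtain ⟨a, ha⟩ := exists_eq_symm_of_fst_eq (rfl : (F.e u).1 = (F.e u).1)
    obtain ⟨b, hb⟩ := exists_eq_symm_of_fst_eq (fst_eq v hv)
    rw [hF.isNullOne_block_iff]
    intro h0
    have hba : F.block M (F.e u).1 b a ≠ 0 := digraph_block_adj.2 (ha ▸ hb ▸ huv)
    exact hba (by rw [h0]; rfl)
  exact ⟨(F.e u).1, ⟨⟨(hF.2 _).resolve_right not_null, not_null⟩,
    fun k hk => not_not.1 (mt (eq_of_not_null k) hk)⟩, fun i hi => eq_of_not_null i hi.1.2⟩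

end BlockPerm

section Sweep

variable {ι κ R : Type*} [Fintype ι] [DecidableEq ι] [Semiring R]

/-- The transition matrix of layer `j` of an arbitrary matrix `A`, when `ℓ x` is the layer in
which the state variable `x` is updated. -/
def layerUpdate [DecidableEq κ] (ℓ : ι → κ) (A : Matrix ι ι R) (j : κ) : Matrix ι ι R :=
  Matrix.of fun x y => if ℓ x = j then A x y else (1 : Matrix ι ι R) x y

/-- The transition matrix of the updates of the layers in the list `l`, carried out from its head
to its last entry, so that the head is the rightmost factor. Lists make partial iterations
available. -/
def sweep [DecidableEq κ] (ℓ : ι → κ) (A : Matrix ι ι R) (l : List κ) : Matrix ι ι R :=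
  (l.map (layerUpdate ℓ A)).reverse.prod

lemma sweep_append [DecidableEq κ] (ℓ : ι → κ) (A : Matrix ι ι R) (l₁ l₂ : List κ) :
    sweep ℓ A (l₁ ++ l₂) = sweep ℓ A l₂ * sweep ℓ A l₁ := by
  simp [sweep]

lemma sweep_singleton [DecidableEq κ] (ℓ : ι → κ) (A : Matrix ι ι R) (j : κ) :
    sweep ℓ A [j] = layerUpdate ℓ A j := by
  simp [sweep]

lemma sweep_apply_of_notMem [DecidableEq κ] {ℓ : ι → κ} (A : Matrix ι ι R) {l : List κ} {x : ι}
    (hx : ℓ x ∉ l) (y : ι) : sweep ℓ A l x y = (1 : Matrix ι ι R) x y := by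
  induction l generalizing y with
  | nil => simp [sweep]
  | cons j l ih =>
    rw [List.mem_cons, not_or] at hx
    rw [← List.singleton_append, sweep_append, sweep_singleton, Matrix.mul_apply]
    simp only [ih hx.2, ← Matrix.mul_apply, one_mul]
    exact if_neg hx.1

lemma sweep_append_apply_of_notMem [DecidableEq κ] {ℓ : ι → κ} (A : Matrix ι ι R)
    (l₁ : List κ) {l₂ : List κ} {x : ι} (hx : ℓ x ∉ l₂) (y : ι) :
    sweep ℓ A (l₁ ++ l₂) x y = sweep ℓ A l₁ x y := by
  simp [sweep_append, Matrix.mul_apply, sweep_apply_of_notMem A hx, Matrix.one_apply]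

lemma sweep_apply [LinearOrder κ] {ℓ : ι → κ} (A : Matrix ι ι R) {l : List κ}
    (hl : l.Pairwise (· < ·)) (hℓ : ∀ x, ℓ x ∈ l) (x y : ι) :
    sweep ℓ A l x y =
      ∑ z, A x z * if ℓ z < ℓ x then sweep ℓ A l z y else (1 : Matrix ι ι R) z y := by
  obtain ⟨l₁, l₂, hsplit⟩ := List.append_of_mem (hℓ x)
  rw [hsplit] at hl ⊢
  obtain ⟨-, htail, hlt⟩ := List.pairwise_append.1 hl
  have before : ∀ j ∈ l₁, j < ℓ x := fun j hj => hlt j hj _ List.mem_cons_self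
  have after : ∀ j ∈ l₂, ℓ x < j := (List.pairwise_cons.1 htail).1
  have hrow : sweep ℓ A (l₁ ++ ℓ x :: l₂) x y = ∑ z, A x z * sweep ℓ A l₁ z y := by
    rw [List.append_cons, sweep_append_apply_of_notMem A _ fun h => (after _ h).false,
      sweep_append, sweep_singleton, Matrix.mul_apply]
    simp [layerUpdate]
  rw [hrow]
  refine Finset.sum_congr rfl fun z _ => congrArg _ ?_
  split_ifs with hz
  · refine (sweep_append_apply_of_notMem A l₁ (fun h => ?_) y).symm
    obtain h | h := List.mem_cons.1 h
    · exact hz.ne h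
    · exact (hz.trans (after _ h)).false
  · exact sweep_apply_of_notMem A (fun h => hz (before _ h)) y

end Sweep

section LayeredProduct

variable {ι R : Type*} [Fintype ι] [DecidableEq ι] {J : ℕ}

/-- The transition matrix of one iteration of the row layered schedule for an arbitrary matrix `A`,
when `ℓ x` is the layer in which the state variable `x` is updated; the last layer is the leftmost
factor. -/
def layeredProduct [Semiring R] (ℓ : ι → Fin J) (A : Matrix ι ι R) : Matrix ι ι R :=
  (List.ofFn (layerUpdate ℓ A)).reverse.prod

lemma layeredProduct_apply [Semiring R] (ℓ : ι → Fin J) (A : Matrix ι ι R) (x y : ι) :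
    layeredProduct ℓ A x y =
      ∑ z with ℓ z < ℓ x, A x z * layeredProduct ℓ A z y + if ℓ x ≤ ℓ y then A x y else 0 := by
  have hsweep : layeredProduct ℓ A = sweep ℓ A (List.finRange J) := by
    rw [layeredProduct, sweep, List.ofFn_eq_map]
  rw [hsweep, sweep_apply A (List.pairwise_lt_finRange J) fun z => List.mem_finRange (ℓ z)]
  simp [Finset.sum_ite, Matrix.one_apply]

lemma layeredProduct_apply_eq_zero [Semiring R] {ℓ : ι → Fin J} {A : Matrix ι ι R} {y : ι}
    (hy : ∀ x, A x y ≠ 0 → ℓ y < ℓ x) (x : ι) : layeredProduct ℓ A x y = 0 := by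
  induction hj : ℓ x using WellFoundedLT.induction generalizing x with
  | ind j ih =>
    subst hj
    have hearlier : ∑ z with ℓ z < ℓ x, A x z * layeredProduct ℓ A z y = 0 :=
      Finset.sum_eq_zero fun z hz => by rw [ih _ (Finset.mem_filter.1 hz).2 z rfl, mul_zero]
    rw [layeredProduct_apply, hearlier, zero_add, ite_eq_right_iff]
    exact fun hxy => by_contra fun hA => (hy x hA).not_ge hxy

lemma layeredProduct_apply_eq_zero_of_first [Semiring R] {ℓ : ι → Fin J} {A : Matrix ι ι R}
    (hA : ∀ x y, A x y ≠ 0 → ℓ x ≠ ℓ y) {y : ι} (hy : ∀ x, ℓ y ≤ ℓ x) (x : ι) :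
    layeredProduct ℓ A x y = 0 :=
  layeredProduct_apply_eq_zero (fun z hz => (hy z).lt_of_ne (hA z y hz).symm) x

lemma layeredProduct_nonneg [Semiring R] [PartialOrder R] [IsOrderedRing R] {ℓ : ι → Fin J}
    {A : Matrix ι ι R} (hA : ∀ x y, 0 ≤ A x y) (x y : ι) : 0 ≤ layeredProduct ℓ A x y := by
  induction hj : ℓ x using WellFoundedLT.induction generalizing x with
  | ind j ih =>
    subst hj
    rw [layeredProduct_apply]
    refine add_nonneg (Finset.sum_nonneg fun z hz => ?_) (ite_nonneg (hA x y) le_rfl)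
    exact mul_nonneg (hA x z) (ih _ (Finset.mem_filter.1 hz).2 z rfl)

variable {ℓ : ι → Fin J} {A : Matrix ι ι ℝ}

lemma digraph_layeredProduct_adj_iff (hA : ∀ x y, 0 ≤ A x y) {x y : ι} :
    (digraph (layeredProduct ℓ A)).Adj x y ↔
      ((digraph A).Adj x y ∧ ℓ y ≤ ℓ x) ∨
        ∃ z, (digraph (layeredProduct ℓ A)).Adj x z ∧ (digraph A).Adj z y ∧ ℓ z < ℓ y := by
  have hterm : ∀ z, 0 ≤ A y z * layeredProduct ℓ A z x := fun z =>
    mul_nonneg (hA y z) (layeredProduct_nonneg hA z x)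
  change layeredProduct ℓ A y x ≠ 0 ↔ (A y x ≠ 0 ∧ ℓ y ≤ ℓ x) ∨
    ∃ z, layeredProduct ℓ A z x ≠ 0 ∧ A y z ≠ 0 ∧ ℓ z < ℓ y
  rw [layeredProduct_apply, Ne, add_eq_zero_iff_of_nonneg (Finset.sum_nonneg fun z _ => hterm z)
    (ite_nonneg (hA y x) le_rfl), Finset.sum_eq_zero_iff_of_nonneg fun z _ => hterm z]
  simp only [Finset.mem_filter_univ, mul_eq_zero, ite_eq_right_iff]
  grind

/-- The walk from `w` is consumed step by step; `w` itself may be a sink of the layered digraph,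
so the non-sink `x` from which `w` was reached is carried along instead. -/
lemma transGen_removeSinks_of_reflTransGen (hA : ∀ x y, 0 ≤ A x y) {w : ι}
    {x y : {x // ∃ y, (digraph (layeredProduct ℓ A)).Adj x y}}
    (hxw : (digraph (layeredProduct ℓ A)).Adj x w)
    (hwy : Relation.ReflTransGen (digraph A).Adj w y) :
    Relation.TransGen (removeSinks (digraph (layeredProduct ℓ A))).Adj x y := by
  induction hwy using Relation.ReflTransGen.head_induction_on generalizing x with
  | refl => exact .single hxw
  | @head w w' hww' _ ih =>
    rcases le_or_gt (ℓ w') (ℓ w) with hle | hlt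
    · have hadj := (digraph_layeredProduct_adj_iff hA).2 (.inl ⟨hww', hle⟩)
      exact .head (show (removeSinks _).Adj x ⟨w, w', hadj⟩ from hxw) (ih hadj)
    · exact ih ((digraph_layeredProduct_adj_iff hA).2 (.inr ⟨w, hxw, hww', hlt⟩))

lemma transGen_removeSinks_layeredProduct (hA : ∀ x y, 0 ≤ A x y)
    (hconn : StronglyConnected (digraph A))
    (x y : {x // ∃ y, (digraph (layeredProduct ℓ A)).Adj x y}) :
    Relation.TransGen (removeSinks (digraph (layeredProduct ℓ A))).Adj x y :=
  let ⟨w, hxw⟩ := x.2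
  transGen_removeSinks_of_reflTransGen hA hxw (hconn w y)

theorem stronglyConnected_removeSinks_layeredProduct (hA : ∀ x y, 0 ≤ A x y)
    (hconn : StronglyConnected (digraph A)) :
    StronglyConnected (removeSinks (digraph (layeredProduct ℓ A))) :=
  fun x y => (transGen_removeSinks_layeredProduct hA hconn x y).to_reflTransGen

lemma exists_adj_removeSinks_layeredProduct [Nontrivial ι] (hA : ∀ x y, 0 ≤ A x y)
    (hconn : StronglyConnected (digraph A)) :
    ∃ x y, (removeSinks (digraph (layeredProduct ℓ A))).Adj x y := by
  obtain ⟨x, hx⟩ := Finite.exists_max ℓ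
  obtain ⟨y, hxy⟩ := hconn.exists_adj x
  have hadj := (digraph_layeredProduct_adj_iff hA).2 (.inl ⟨hxy, hx y⟩)
  let x' : {x // ∃ y, (digraph (layeredProduct ℓ A)).Adj x y} := ⟨x, y, hadj⟩
  obtain ⟨z, hz, -⟩ :=
    Relation.TransGen.head'_iff.1 (transGen_removeSinks_layeredProduct hA hconn x' x')
  exact ⟨x', z, hz⟩

end LayeredProduct

section TrappingSets

variable {mb nb p : ℕ} {H : Matrix (CN mb p) (VN nb p) (ZMod 2)} {S : Finset (VN nb p)}

lemma IsQC.eq_of_fst_eq (hH : IsQC H) {c c' : CN mb p} {v : VN nb p} (hc : H c v = 1)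
    (hc' : H c' v = 1) (h : c.1 = c'.1) : c = c' := by
  obtain ⟨i, r⟩ := c
  obtain ⟨_, r'⟩ := c'
  obtain ⟨j, k⟩ := v
  obtain rfl : i = _ := h
  obtain h0 | ⟨s, hs⟩ := hH i j
  · simp [h0] at hc
  · have hr : k = r + s := by simpa [hs] using hc
    have hr' : k = r' + s := by simpa [hs] using hc'
    rw [add_right_cancel (hr.symm.trans hr')]

lemma floodingMatrix_nonneg (x y : StateVar H S) : 0 ≤ floodingMatrix H S x y :=
  ite_nonneg zero_le_one le_rfl

lemma floodingMatrix_ne_zero_iff {x y : StateVar H S} :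
    floodingMatrix H S x y ≠ 0 ↔ y.1.2 ≠ x.1.2 ∧ H y.1.2 x.1.1 = 1 ∧ y.1.1 ≠ x.1.1 := by
  simp [floodingMatrix]

variable [NeZero p] {π : Equiv.Perm (Fin mb)}

lemma fst_eq_of_layer_eq {x y : StateVar H S} (h : layer H S π x = layer H S π y) :
    x.1.2.1 = y.1.2.1 :=
  π.injective (congrArg Subtype.val (((layers H S π).orderIsoOfFin rfl).symm.injective h))

lemma IsQC.layer_ne_of_floodingMatrix_ne_zero (hH : IsQC H) {x y : StateVar H S}
    (h : floodingMatrix H S x y ≠ 0) : layer H S π x ≠ layer H S π y := by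
  obtain ⟨hne, hyx, -⟩ := floodingMatrix_ne_zero_iff.1 h
  exact fun hl => hne (hH.eq_of_fst_eq hyx x.2.2.2 (fst_eq_of_layer_eq hl).symm)

lemma layer_surjective : Function.Surjective (layer H S π) := by
  intro j
  obtain ⟨c, hc, hcj⟩ := Finset.mem_image.1 ((layers H S π).orderIsoOfFin rfl j).2
  have hmis : IsMissatisfied H S c := (Finset.mem_filter.1 hc).2
  obtain ⟨v, hv⟩ := Finset.card_pos.1 hmis.1
  obtain ⟨hvS, hcv⟩ := Finset.mem_filter.1 hv
  exact ⟨⟨(v, c), hvS, hmis, hcv⟩, (OrderIso.symm_apply_eq _).2 (Subtype.ext hcj)⟩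

lemma IsLETS.nontrivial_stateVar (hS : IsLETS H S) : Nontrivial (StateVar H S) := by
  obtain ⟨v, hv⟩ := hS.nonempty
  obtain ⟨c, hc, c', hc', hne⟩ := Finset.one_lt_card.1 (hS.leafless v hv)
  exact ⟨⟨(v, c), hv, (Finset.mem_filter.1 hc).2⟩, ⟨(v, c'), hv, (Finset.mem_filter.1 hc').2⟩,
    fun h => hne (congrArg (fun x => x.1.2) h)⟩

end TrappingSets

end LETS

open LETS in
theorem mainTheorem3_general {ι : Type*} [Fintype ι] [DecidableEq ι] [Nontrivial ι] {J : ℕ}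
    (ℓ : ι → Fin J) (hℓ : Function.Surjective ℓ) (A : Matrix ι ι ℝ) (hA : ∀ x y, 0 ≤ A x y)
    (hAℓ : ∀ x y, A x y ≠ 0 → ℓ x ≠ ℓ y) :
    ((∀ x y, 0 ≤ layeredProduct ℓ A x y) ∧ IsReducible (layeredProduct ℓ A)) ∧
    (∃ hJ : 0 < J,
      0 < Nat.card {x // ℓ x = ⟨0, hJ⟩} ∧
      (∀ x y, ℓ y = ⟨0, hJ⟩ → layeredProduct ℓ A x y = 0) ∧
      Nat.card {x // ℓ x = ⟨0, hJ⟩} ≤ Nat.card {y // ∀ x, layeredProduct ℓ A x y = 0}) ∧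
    (∀ x, (∀ y, (digraph A).Adj x y → ℓ x < ℓ y) →
      ∀ y, ¬ (digraph (layeredProduct ℓ A)).Adj x y) ∧
    (IsIrreducible A →
      StronglyConnected (removeSinks (digraph (layeredProduct ℓ A))) ∧
      (∃ F : BlockPerm ι, F.IsFrobeniusNormalForm (layeredProduct ℓ A)) ∧
      ∀ F : BlockPerm ι, F.IsFrobeniusNormalForm (layeredProduct ℓ A) →
        ∃! i : Fin F.t, F.IsIrreducibleBlock (layeredProduct ℓ A) i ∧
          ∀ k, k ≠ i → IsNullOne (F.block (layeredProduct ℓ A) k)) := by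
  have hJ : 0 < J := (ℓ (Classical.arbitrary ι)).pos
  have first_column : ∀ x y, ℓ y = ⟨0, hJ⟩ → layeredProduct ℓ A x y = 0 := fun x y hy =>
    layeredProduct_apply_eq_zero_of_first hAℓ (fun z => hy ▸ Nat.zero_le (ℓ z)) x
  obtain ⟨x₀, hx₀⟩ := hℓ ⟨0, hJ⟩
  have : Nonempty {x // ℓ x = ⟨0, hJ⟩} := ⟨⟨x₀, hx₀⟩⟩
  refine ⟨⟨layeredProduct_nonneg hA, isReducible_of_column_eq_zero fun x => first_column x x₀ hx₀⟩,
    ⟨hJ, Nat.card_pos, first_column, Finite.card_le_of_embedding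
      (Subtype.impEmbedding _ _ fun y hy x => first_column x y hy)⟩,
    fun x hx y hxy => hxy (layeredProduct_apply_eq_zero hx y), fun hirr => ?_⟩
  have hconn := (isIrreducible_iff_stronglyConnected.1 hirr).2
  have hsinks := stronglyConnected_removeSinks_layeredProduct (ℓ := ℓ) hA hconn
  exact ⟨hsinks, BlockPerm.exists_isFrobeniusNormalForm (layeredProduct_nonneg hA), fun F hF =>
    hF.existsUnique_isIrreducibleBlock hsinks (exists_adj_removeSinks_layeredProduct hA hconn)⟩

theorem mainTheorem3 {mb nb p : ℕ} [NeZero p]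
    (H : Matrix (LETS.CN mb p) (LETS.VN nb p) (ZMod 2)) (hH : LETS.IsQC H)
    (π : Equiv.Perm (Fin mb)) (S : Finset (LETS.VN nb p)) (hS : LETS.IsLETS H S) :
    -- the layered transition matrix is non-negative and reducible
    ((∀ x y, 0 ≤ LETS.layeredMatrix H S π x y) ∧
      LETS.IsReducible (LETS.layeredMatrix H S π)) ∧
    -- there is a first layer; its column block is zero, and `n_z` is at least its size
    (∃ hJ : 0 < LETS.numLayers H S π,
      0 < LETS.layerSize H S π ⟨0, hJ⟩ ∧
      (∀ x y, LETS.layer H S π y = ⟨0, hJ⟩ → LETS.layeredMatrix H S π x y = 0) ∧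
      LETS.layerSize H S π ⟨0, hJ⟩ ≤ LETS.numZeroColumns H S π) ∧
    -- nodes all of whose children in the flooding digraph are updated in later layers
    (∀ x, (∀ y, (LETS.digraph (LETS.floodingMatrix H S)).Adj x y →
        LETS.layer H S π x < LETS.layer H S π y) →
      ∀ y, ¬ (LETS.digraph (LETS.layeredMatrix H S π)).Adj x y) ∧
    -- the case of an irreducible flooding matrix
    (LETS.IsIrreducible (LETS.floodingMatrix H S) →
      LETS.StronglyConnected (LETS.removeSinks (LETS.digraph (LETS.layeredMatrix H S π))) ∧
      (∃ F : LETS.BlockPerm (LETS.StateVar H S),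
        F.IsFrobeniusNormalForm (LETS.layeredMatrix H S π)) ∧
      ∀ F : LETS.BlockPerm (LETS.StateVar H S),
        F.IsFrobeniusNormalForm (LETS.layeredMatrix H S π) →
        ∃! i : Fin F.t, F.IsIrreducibleBlock (LETS.layeredMatrix H S π) i ∧
          ∀ k, k ≠ i → LETS.IsNullOne (F.block (LETS.layeredMatrix H S π) k)) :=
  have := hS.nontrivial_stateVar
  mainTheorem3_general (LETS.layer H S π) LETS.layer_surjective (LETS.floodingMatrix H S)
    LETS.floodingMatrix_nonneg fun _ _ => hH.layer_ne_of_floodingMatrix_ne_zero
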